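/- **Conventions.** Categories have small hom-sets and coproducts are indexed by (small) sets. For an object $X$ of an abelian category $\mathcal{C}$, let $\mathrm{proj.dim}\,X=\sup\{n\ge 0 \mid \mathrm{Ext}^n_{\mathcal{C}}(X,Y)\ne 0 \text{ for some } Y\}$ and dually $\mathrm{inj.dim}\,X=\sup\{n\ge 0 \mid \mathrm{Ext}^n_{\mathcal{C}}(Y,X)\ne 0 \text{ for some } Y\}$, with $\sup\emptyset=-\infty$ (the dimension of a zero object). An object $T$ of $\mathcal{C}$ is a *generator* if the functor $\mathrm{Hom}_{\mathcal{C}}(T,-)$ is faithful. An abelian category $\mathcal{C}$ is *Gorenstein* if * (G1) $\mathcal{C}$ satisfies (AB4) (it has arbitrary set-indexed coproducts and these preserve short exact sequences), it has enough injective objects, and it has a generator of finite projective dimension; * (G2) an object of $\mathcal{C}$ has finite projective dimension if and only if it has finite injective dimension; * (G3) the injective objects of $\mathcal{C}$ have finite, uniformly bounded projective dimension. Its *Gorenstein dimension* is $\mathrm{G.dim}\,\mathcal{C}=\sup\{\mathrm{proj.dim}\,I \mid I \text{ an injective object of } \mathcal{C}\}$ (a maximum when $\mathcal{C}$ is Gorenstein).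 **Theorem.** Let $\mathcal{A}$ be a Gorenstein category and let $T$ be a generator of $\mathcal{A}$ with $\mathrm{proj.dim}\,T<\infty$. Let $\mathcal{B}\subseteq\mathcal{A}$ be a Serre subcategory (a full subcategory containing the zero objects and closed under subobjects, quotient objects and extensions) that is closed under arbitrary set-indexed coproducts. Let $\mathcal{A}/\mathcal{B}$ be the quotient category, obtained from $\mathcal{A}$ by formally inverting all morphisms whose kernel and cokernel both lie in $\mathcal{B}$, and let $\pi:\mathcal{A}\to\mathcal{A}/\mathcal{B}$ be the canonical functor. Assume that $\pi$ sends injective objects to injective objects and that $\mathrm{proj.dim}\,\pi(T)<\infty$. Then the (abelian) category $\mathcal{A}/\mathcal{B}$ is Gorenstein, and $$\mathrm{G.dim}\,\mathcal{A}/\mathcal{B}\ \le\ \mathrm{G.dim}\,\mathcal{A}+\mathrm{proj.dim}\,\pi(T).$$ -/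

import Mathlib

universe w v u

namespace CategoryTheory

open Limits

/-- The Gabriel quotient `A/B` of an abelian category by a Serre subcategory `B`, given as a
Serre class `P` of objects: the category obtained from `A` by formally inverting the morphisms
whose kernel and cokernel both lie in `B`. -/
abbrev SerreQuotient {A : Type u} [Category.{v} A] [Abelian A] (P : ObjectProperty A)
    [P.IsSerreClass] : Type u :=
  P.isoModSerre.Localization

/-- The canonical functor `π : A ⥤ A/B`. -/
abbrev SerreQuotient.π {A : Type u} [Category.{v} A] [Abelian A] (P : ObjectProperty A)
    [P.IsSerreClass] : A ⥤ SerreQuotient P :=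
  P.isoModSerre.Q

/-- The quotient `A/B` is abelian; its additive structure is the one for which `π` is additive. -/
noncomputable instance SerreQuotient.abelian {A : Type u} [Category.{v} A] [Abelian A]
    (P : ObjectProperty A) [P.IsSerreClass] : Abelian (SerreQuotient P) :=
  ObjectProperty.SerreClassLocalization.abelian P.isoModSerre.Q P

/-- An abelian category `C` is a Gorenstein category. The universe `w` is the universe of
(small) sets: the hom-sets of `C` are `w`-small and the set-indexed coproducts are those indexed
by types in `Type w`. (The hom-types of a quotient category a priori live in a larger universe
than those of the original category, so `w` is not tied to the universe of the hom-types.) -/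
structure IsGorensteinCategory (C : Type u) [Category.{v} C] [Abelian C] : Prop where
  /-- the hom-sets are small -/
  locallySmall : LocallySmall.{w} C
  /-- arbitrary (set-indexed) coproducts exist -/
  hasCoproducts : HasCoproducts.{w} C
  /-- coproducts are exact -/
  ab4 : AB4OfSize.{w} C
  /-- every object embeds into an injective object -/
  enoughInjectives : EnoughInjectives C
  /-- there is a generator of finite projective dimension -/
  exists_generator : ∃ T : C, IsSeparator T ∧ projectiveDimension T < ⊤
  /-- finite projective dimension is the same as finite injective dimension -/
  projectiveDimension_lt_top_iff (X : C) :
    projectiveDimension X < ⊤ ↔ injectiveDimension X < ⊤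
  /-- the projective dimensions of the injective objects are finite and uniformly bounded -/
  exists_bound : ∃ n : ℕ, ∀ I : C, Injective I → projectiveDimension I ≤ n

/-- The Gorenstein dimension of an abelian category: the supremum of the projective dimensions
of its injective objects. As for `projectiveDimension`, its value for a zero category is
`⊥` (that is, `-∞`). In a Gorenstein category the supremum is a maximum. -/
noncomputable def gorensteinDimension (C : Type u) [Category.{v} C] [Abelian C] : WithBot ℕ∞ :=
  ⨆ (I : C) (_ : Injective I), projectiveDimension I

end CategoryTheory

open CategoryTheory

-- Since `B` is closed under coproducts, π is exact and preserves coproducts, so every object of the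
-- quotient is an epimorphic image of some π(∐T). These objects have projective dimension at most t
-- = proj.dim π(T). An injective of the quotient is a retract of π(J) with J injective. Splice m
-- syzygy sequences whose middle terms are coproducts of T, where m exceeds proj.dim J: the
-- resulting class in Ext^m(J, K) is zero, yet composition with its image under π hits every
-- extension of π(J) in degree at least m + t. Hence proj.dim π(J) ≤ proj.dim J + t, giving (G3) and
-- the inequality. For (G2), ∐T has finite injective dimension and π preserves this, so the dual
-- splicing argument bounds injective dimensions; the converse uses injective coresolutions.

universe w' v' u'

namespace CategoryTheory

open Limits Abelian

/-! ### Ext and homological dimensions -/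

section

variable {C : Type u} [Category.{v} C] [Abelian C]

/-- Dimension shifting in the second variable, along an embedding of `Y` into an injective;
exactness of coproducts is not needed. -/
lemma Abelian.Ext.mk₀_cofan_inj_comp_injective [HasExt.{w'} C] {J : Type w} {X : J → C}
    {c : Cofan X} (hc : IsColimit c) [EnoughInjectives C] (n : ℕ) :
    ∀ {Y : C} (e : Ext c.pt Y n),
      (∀ j, (Ext.mk₀ (c.inj j)).comp e (zero_add n) = 0) → e = 0 := by
  induction n with
  | zero =>
    intro Y e he
    obtain ⟨f, rfl⟩ := Ext.homEquiv₀.symm.surjective e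
    have : f = 0 := Cofan.IsColimit.hom_ext hc _ _ fun j ↦ by
      have := he j
      rw [Ext.homEquiv₀_symm_apply, Ext.mk₀_comp_mk₀] at this
      rw [Limits.comp_zero]
      exact Ext.homEquiv₀.symm.injective (by simpa only [Ext.homEquiv₀_symm_apply, Ext.mk₀_zero])
    simp [this]
  | succ n ih =>
    intro Y e he
    let ⟨p⟩ := EnoughInjectives.presentation Y
    have h : (ShortComplex.mk _ _ (cokernel.condition p.f)).ShortExact :=
      { exact := ShortComplex.exact_cokernel p.f }
    obtain ⟨x, rfl⟩ := Ext.covariant_sequence_exact₁ c.pt h e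
      (by apply Ext.eq_zero_of_injective) rfl
    have hx (j : J) : ∃ y : Ext (X j) p.J n,
        y.comp (Ext.mk₀ (cokernel.π p.f)) (add_zero n) =
          (Ext.mk₀ (c.inj j)).comp x (zero_add n) := by
      refine Ext.covariant_sequence_exact₃ (X j) h _ rfl ?_
      rw [← he j, Ext.comp_assoc _ _ _ _ _ (by lia)]
    choose y hy using hx
    obtain ⟨z, hz⟩ : ∃ z : Ext c.pt p.J n,
        z.comp (Ext.mk₀ (cokernel.π p.f)) (add_zero n) = x := by
      suffices ∃ z : Ext c.pt p.J n, ∀ j, (Ext.mk₀ (c.inj j)).comp z (zero_add n) = y j by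
        obtain ⟨z, hz⟩ := this
        refine ⟨z, sub_eq_zero.1 (ih _ fun j ↦ ?_)⟩
        rw [sub_eq_add_neg, Ext.comp_add, Ext.comp_neg, ← sub_eq_add_neg, ← hy, ← hz,
          Ext.comp_assoc _ _ _ _ (add_zero n) (by lia), sub_self]
      obtain _ | n := n
      -- Only degree 0 needs gluing; in positive degree every class with injective target vanishes.
      · refine ⟨Ext.mk₀ (Cofan.IsColimit.desc hc fun j ↦ Ext.homEquiv₀ (y j)), fun j ↦ ?_⟩
        rw [Ext.mk₀_comp_mk₀, Cofan.IsColimit.fac]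
        exact Ext.homEquiv₀.symm_apply_apply (y j)
      · exact ⟨0, fun j ↦ by rw [Ext.comp_zero]; exact (Ext.eq_zero_of_injective _).symm⟩
    rw [← hz, Ext.comp_assoc _ _ _ _ (zero_add 1) (by lia), h.comp_extClass, Ext.comp_zero]

lemma hasProjectiveDimensionLT_of_isColimit_cofan {J : Type w} {X : J → C}
    {c : Cofan X} (hc : IsColimit c) [EnoughInjectives C] (n : ℕ)
    (hX : ∀ j, HasProjectiveDimensionLT (X j) n) : HasProjectiveDimensionLT c.pt n := by
  let := HasExt.standard C
  refine hasProjectiveDimensionLT_of_enoughInjectives _ _ fun Y ↦ ⟨fun e₁ e₂ ↦ ?_⟩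
  refine sub_eq_zero.1 (Ext.mk₀_cofan_inj_comp_injective hc n _ fun j ↦ ?_)
  exact Ext.eq_zero_of_hasProjectiveDimensionLT _ n le_rfl

/-- An embedding of `colimit F` into an injective extends, component by component, along F → G, so
it factors through the map of coproducts, which is therefore mono. -/
lemma hasExactColimitsOfShape_discrete_of_enoughInjectives [EnoughInjectives C] (J : Type w)
    [HasColimitsOfShape (Discrete J) C] : HasExactColimitsOfShape (Discrete J) C := by
  have : (colim (J := Discrete J) (C := C)).PreservesMonomorphisms := by
    refine ⟨fun {F G} α _ ↦ ?_⟩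
    have hα (j : Discrete J) : Mono (α.app j) := inferInstance
    let i : colimit F ⟶ _ := Injective.ι (colimit F)
    have : Mono i := inferInstanceAs (Mono (Injective.ι (colimit F)))
    let c : Cocone G := ⟨Injective.under (colimit F), Discrete.natTrans
      fun j ↦ Injective.factorThru (J := Injective.under (colimit F))
        (colimit.ι F j ≫ i) (α.app j)⟩
    have : colimMap α ≫ colimit.desc G c = i := by
      refine colimit.hom_ext fun j ↦ ?_
      simp [c]
    exact mono_of_mono_fac this
  exact hasExactColimitsOfShape_of_preservesMono C (Discrete J)

/-- If `X` has finite projective dimension and every object is a quotient of an object of finite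
injective dimension, then `X` has finite injective dimension. -/
lemma exists_hasInjectiveDimensionLT_of_hasProjectiveDimensionLT
    (h : ∀ X : C, ∃ (P : C) (p : P ⟶ X) (s : ℕ), Epi p ∧ HasInjectiveDimensionLT P s)
    (X : C) (m : ℕ) [HasProjectiveDimensionLT X m] : ∃ s, HasInjectiveDimensionLT X s := by
  let := HasExt.standard C
  -- `e` splices m syzygy sequences. Composition with it is injective in degrees ≥ `s`, but `e` is
  -- zero.
  obtain ⟨K, e, s, he⟩ : ∃ (K : C) (e : Ext X K m) (s : ℕ), ∀ (W : C) (i : ℕ), s ≤ i →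
      ∀ (x : Ext W X i), x.comp e rfl = 0 → x = 0 := by
    induction m with
    | zero => exact ⟨X, Ext.mk₀ (𝟙 X), 0, fun W i _ x hx ↦ by simpa using hx⟩
    | succ m ih =>
      obtain ⟨K, e, s, he⟩ := ih
      obtain ⟨P, p, s', _, _⟩ := h K
      have hp : (ShortComplex.mk _ _ (kernel.condition p)).ShortExact :=
        { exact := ShortComplex.exact_kernel p }
      refine ⟨kernel p, e.comp hp.extClass rfl, max s s', fun W i hi x hx ↦ ?_⟩
      refine he W i ((le_max_left _ _).trans hi) x ?_
      obtain ⟨y, hy⟩ := Ext.covariant_sequence_exact₃ W hp (x.comp e rfl) rfl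
        (by rw [Ext.comp_assoc _ _ _ _ rfl (by lia), hx])
      rw [← hy, Ext.eq_zero_of_hasInjectiveDimensionLT (X := P) y s' (by lia), Ext.zero_comp]
  refine ⟨s, HasInjectiveDimensionLT.mk fun i hi W x ↦ he W i hi x ?_⟩
  rw [e.eq_zero_of_hasProjectiveDimensionLT m le_rfl, Ext.comp_zero]

/-- The bound `n` survives each cosyzygy step, since a kernel of an epimorphism between objects of
projective dimension < `n` is again one. -/
lemma exists_hasProjectiveDimensionLT_of_hasInjectiveDimensionLT [EnoughInjectives C] (n : ℕ)
    (h : ∀ I : C, Injective I → HasProjectiveDimensionLT I n) (m : ℕ) :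
    ∀ (X : C) [HasInjectiveDimensionLT X (m + 1)], HasProjectiveDimensionLT X n := by
  induction m with
  | zero =>
    intro X _
    exact h X (injective_iff_hasInjectiveDimensionLT_one.2 inferInstance)
  | succ m ih =>
    intro X hX
    let ⟨p⟩ := EnoughInjectives.presentation X
    have hp : (ShortComplex.mk _ _ (cokernel.condition p.f)).ShortExact :=
      { exact := ShortComplex.exact_cokernel p.f }
    have : HasInjectiveDimensionLT (cokernel p.f) (m + 1) :=
      (hp.hasInjectiveDimensionLT_X₃_iff m p.injective).2 hX
    have := ih (cokernel p.f)
    exact hp.hasProjectiveDimensionLT_X₁ n (h _ p.injective)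
      (hasProjectiveDimensionLT_of_ge (cokernel p.f) n (n + 1) (by lia))

variable {D : Type u'} [Category.{v'} D] [Abelian D]
  (F : C ⥤ D) [F.Additive] [PreservesFiniteLimits F] [PreservesFiniteColimits F]

lemma Functor.hasInjectiveDimensionLT_obj [EnoughInjectives C] [F.PreservesInjectiveObjects]
    (m : ℕ) : ∀ (X : C) [HasInjectiveDimensionLT X (m + 1)],
      HasInjectiveDimensionLT (F.obj X) (m + 1) := by
  induction m with
  | zero =>
    intro X _
    have : Injective X := injective_iff_hasInjectiveDimensionLT_one.2 inferInstance
    have : Injective (F.obj X) := F.injective_obj X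
    infer_instance
  | succ m ih =>
    intro X hX
    let ⟨p⟩ := EnoughInjectives.presentation X
    have := p.injective
    have : Injective (F.obj p.J) := F.injective_obj p.J
    have hp : (ShortComplex.mk _ _ (cokernel.condition p.f)).ShortExact :=
      { exact := ShortComplex.exact_cokernel p.f }
    have : HasInjectiveDimensionLT (cokernel p.f) (m + 1) :=
      (hp.hasInjectiveDimensionLT_X₃_iff m p.injective).2 hX
    exact ((hp.map_of_exact F).hasInjectiveDimensionLT_X₃_iff m
      (inferInstanceAs (Injective (F.obj p.J)))).1 (ih (cokernel p.f))

/-- An exact functor `F` raises projective dimensions by at most `t` if every object is a quotient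
of an object whose image by `F` has projective dimension at most `t`. -/
lemma Functor.hasProjectiveDimensionLT_obj_of_exists_epi (t : ℕ)
    (h : ∀ X : C, ∃ (P : C) (p : P ⟶ X), Epi p ∧ HasProjectiveDimensionLT (F.obj P) (t + 1))
    (X : C) (m : ℕ) [HasProjectiveDimensionLT X m] :
    HasProjectiveDimensionLT (F.obj X) (m + t) := by
  let := HasExt.standard C
  let := HasExt.standard D
  -- The splicing takes place in `C`, where `e` must vanish; surjectivity is tested in `D`.
  obtain ⟨K, e, he⟩ : ∃ (K : C) (e : Ext X K m), ∀ (Z : D) (i j : ℕ) (hij : m + i = j), t ≤ i →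
      ∀ (x : Ext (F.obj X) Z j), ∃ y : Ext (F.obj K) Z i, (e.mapExactFunctor F).comp y hij = x := by
    induction m with
    | zero =>
      refine ⟨X, Ext.mk₀ (𝟙 X), fun Z i j hij _ x ↦ ?_⟩
      obtain rfl : i = j := by lia
      exact ⟨x, by simp [Ext.mapExactFunctor_mk₀]⟩
    | succ m ih =>
      obtain ⟨K, e, he⟩ := ih
      obtain ⟨P, p, _, _⟩ := h K
      have hp : (ShortComplex.mk _ _ (kernel.condition p)).ShortExact :=
        { exact := ShortComplex.exact_kernel p }
      refine ⟨Limits.kernel p, e.comp hp.extClass rfl, fun Z i j hij hi x ↦ ?_⟩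
      obtain ⟨y, rfl⟩ := he Z (1 + i) j (by lia) (by lia) x
      obtain ⟨z, rfl⟩ := Ext.contravariant_sequence_exact₃ (hp.map_of_exact F) _ y
        (Ext.eq_zero_of_hasProjectiveDimensionLT (X := F.obj P) _ (t + 1) (by lia)) rfl
      refine ⟨z, ?_⟩
      rw [Ext.mapExactFunctor_comp, Ext.mapExactFunctor_extClass]
      exact Ext.comp_assoc _ _ _ _ _ (by lia)
  refine HasProjectiveDimensionLT.mk fun i hi Z x ↦ ?_
  obtain ⟨k, rfl⟩ := Nat.exists_eq_add_of_le hi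
  obtain ⟨y, rfl⟩ := he Z (t + k) _ (by lia) (by lia) x
  rw [e.eq_zero_of_hasProjectiveDimensionLT m le_rfl, Ext.mapExactFunctor_zero, Ext.zero_comp]

end

lemma LocallySmall.wellPowered_of_isSeparator {C : Type u} [Category.{v} C] [Abelian C]
    [LocallySmall.{w} C] {G : C} (hG : IsSeparator G) : WellPowered.{w} C :=
  wellPowered_of_isDetecting hG.isDetector

lemma exists_epi_sigma_of_isSeparator {C : Type u} [Category.{v} C] [Abelian C]
    [LocallySmall.{w} C] [HasCoproducts.{w} C] {G : C} (hG : IsSeparator G) (X : C) :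
    ∃ (J : Type w) (p : (∐ fun _ : J ↦ G) ⟶ X), Epi p := by
  refine ⟨Shrink.{w} (G ⟶ X), Limits.Sigma.desc fun j ↦ (equivShrink _).symm j, ?_⟩
  rw [Preadditive.epi_iff_cancel_zero]
  intro Y f hf
  refine (Preadditive.isSeparator_iff G).1 hG f fun h ↦ ?_
  have := Sigma.ι (fun _ : Shrink.{w} (G ⟶ X) ↦ G) (equivShrink _ h) ≫= hf
  simpa using this

/-! ### Coproducts and smallness in Serre localizations -/

namespace ObjectProperty

variable {C : Type u} [Category.{v} C] [Abelian C] (P : ObjectProperty C) [P.IsSerreClass]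

section

variable {J : Type w} [HasColimitsOfShape (Discrete J) C]
  [P.IsClosedUnderColimitsOfShape (Discrete J)]

lemma isoModSerre_colimMap [HasExactColimitsOfShape (Discrete J) C]
    {F G : Discrete J ⥤ C} (α : F ⟶ G) (hα : ∀ j, P.isoModSerre (α.app j)) :
    P.isoModSerre (colimMap α) := by
  have : (colim (J := Discrete J) (C := C)).PreservesZeroMorphisms := inferInstance
  constructor
  · refine P.prop_of_iso (PreservesKernel.iso (colim (J := Discrete J) (C := C)) α)
      (P.prop_colimit _ fun j ↦ ?_)
    exact P.prop_of_iso (PreservesKernel.iso ((evaluation (Discrete J) C).obj j) α).symm (hα j).1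
  · refine P.prop_of_iso (PreservesCokernel.iso (colim (J := Discrete J) (C := C)) α)
      (P.prop_colimit _ fun j ↦ ?_)
    exact P.prop_of_iso (PreservesCokernel.iso ((evaluation (Discrete J) C).obj j) α).symm (hα j).2

/-- The image of `f` is a quotient of the coproduct of the images of its restrictions. -/
lemma prop_image_of_colimit {F : Discrete J ⥤ C} {Y : C} (f : colimit F ⟶ Y)
    (hf : ∀ j, P (Abelian.image (colimit.ι F j ≫ f))) : P (Abelian.image f) := by
  let g (j : J) : Abelian.image (colimit.ι F ⟨j⟩ ≫ f) ⟶ Abelian.image f :=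
    kernel.lift _ (Abelian.image.ι _) (by
      rw [← cancel_epi (Abelian.factorThruImage _)]
      simp)
  let q : (∐ fun j : J ↦ Abelian.image (colimit.ι F ⟨j⟩ ≫ f)) ⟶ Abelian.image f := Limits.Sigma.desc g
  let p : colimit F ⟶ ∐ fun j : J ↦ Abelian.image (colimit.ι F ⟨j⟩ ≫ f) :=
    colimit.desc F ⟨_, Discrete.natTrans
      (fun j ↦ Abelian.factorThruImage (colimit.ι F j ≫ f) ≫
        Sigma.ι (fun j : J ↦ Abelian.image (colimit.ι F ⟨j⟩ ≫ f)) j.as)⟩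
  have fac : p ≫ q = Abelian.factorThruImage f := by
    rw [← cancel_mono (Abelian.image.ι f)]
    refine colimit.hom_ext fun j ↦ ?_
    simp [p, q, g]
  have : Epi q := epi_of_epi_fac fac
  exact P.prop_of_epi q (P.prop_colimit _ fun j ↦ hf j)

end

namespace SerreClassLocalization

variable {D : Type u'} [Category.{v'} D] (L : C ⥤ D)
  [L.IsLocalization P.isoModSerre]

include P L in
-- A roof from X to Y can be replaced by its image in X ⨯ Y, so subobjects of X ⨯ Y account for all
-- morphisms.
lemma locallySmall [LocallySmall.{w} C] [WellPowered.{w} C] : LocallySmall.{w} D where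
  hom_small X' Y' := by
    have := Localization.essSurj L P.isoModSerre
    suffices ∀ X Y : C, Small.{w} (L.obj X ⟶ L.obj Y) from
      have := this (L.objPreimage X') (L.objPreimage Y')
      small_map ((L.objObjPreimageIso X').symm.homCongr (L.objObjPreimageIso Y').symm)
    intro X Y
    let S := {R : Subobject (X ⨯ Y) // IsIso (L.map (R.arrow ≫ prod.fst))}
    let φ (R : S) : L.obj X ⟶ L.obj Y :=
      have := R.2
      inv (L.map (R.1.arrow ≫ prod.fst)) ≫ L.map (R.1.arrow ≫ prod.snd)
    refine small_of_surjective (f := φ) fun f ↦ ?_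
    obtain ⟨ψ, rfl⟩ := Localization.exists_rightFraction L P.isoModSerre f
    let m := prod.lift ψ.s ψ.f
    let e := factorThruImageSubobject m
    have h₁ : e ≫ (imageSubobject m).arrow ≫ prod.fst = ψ.s :=
      (imageSubobject_arrow_comp_assoc m _).trans (prod.lift_fst _ _)
    have h₂ : e ≫ (imageSubobject m).arrow ≫ prod.snd = ψ.f :=
      (imageSubobject_arrow_comp_assoc m _).trans (prod.lift_snd _ _)
    -- `e` is epi and its kernel embeds in that of `ψ.s`.
    have he : P.isoModSerre e := P.isoModSerre_of_epi _
      (P.prop_of_mono (kernel.map e ψ.s (𝟙 _) ((imageSubobject m).arrow ≫ prod.fst)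
        (by simpa using h₁)) ψ.hs.1)
    have hs := Localization.inverts L P.isoModSerre _ ψ.hs
    have he' := Localization.inverts L P.isoModSerre _ he
    have hfst : IsIso (L.map ((imageSubobject m).arrow ≫ prod.fst)) := by
      have : IsIso (L.map e ≫ L.map ((imageSubobject m).arrow ≫ prod.fst)) := by
        rw [← L.map_comp, h₁]; exact hs
      exact IsIso.of_isIso_comp_left (L.map e) _
    refine ⟨⟨imageSubobject m, hfst⟩, ?_⟩
    rw [← cancel_epi (L.map ψ.s), MorphismProperty.RightFraction.map_s_comp_map]
    conv_lhs => rw [← h₁, L.map_comp e]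
    simp only [φ, Category.assoc, IsIso.hom_inv_id_assoc]
    rw [← L.map_comp, h₂]

variable [Preadditive D] [L.Additive] {J : Type w} [HasColimitsOfShape (Discrete J) C]
  [P.IsClosedUnderColimitsOfShape (Discrete J)]

include P in
lemma hom_ext_of_colimit {F : Discrete J ⥤ C} {Z : D} {f g : L.obj (colimit F) ⟶ Z}
    (h : ∀ j, L.map (colimit.ι F j) ≫ f = L.map (colimit.ι F j) ≫ g) : f = g := by
  have := Localization.essSurj L P.isoModSerre
  obtain ⟨ψ, hψ⟩ := Localization.exists_leftFraction L P.isoModSerre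
    ((f - g) ≫ (L.objObjPreimageIso Z).inv)
  have hs := Localization.inverts L P.isoModSerre _ ψ.hs
  have hf : ((f - g) ≫ (L.objObjPreimageIso Z).inv) ≫ L.map ψ.s = L.map ψ.f := by
    rw [hψ, MorphismProperty.LeftFraction.map_comp_map_s]
  have : L.map ψ.f = 0 := by
    rw [map_eq_zero_iff L P]
    refine P.prop_image_of_colimit _ fun j ↦ ?_
    rw [← map_eq_zero_iff L P, L.map_comp, ← hf]
    simp [reassoc_of% (h j)]
  rw [this] at hf
  rw [← sub_eq_zero, ← cancel_mono (L.objObjPreimageIso Z).inv, ← cancel_mono (L.map ψ.s), hf]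
  simp

variable [HasExactColimitsOfShape (Discrete J) C]

include P in
variable (J) in
-- Write each leg of a cocone as a roof; the coproduct of the denominators is still inverted, so the
-- roofs assemble into one.
lemma preservesColimitsOfShape_discrete : PreservesColimitsOfShape (Discrete J) L where
  preservesColimit {F} := by
    have := Localization.essSurj L P.isoModSerre
    refine preservesColimit_of_preserves_colimit_cocone (colimit.isColimit F)
      (IsColimit.ofExistsUnique fun s ↦ existsUnique_of_exists_of_unique ?_
        fun _ _ h₁ h₂ ↦ hom_ext_of_colimit P L fun j ↦ (h₁ j).trans (h₂ j).symm)
    choose ψ hψ using fun j ↦ Localization.exists_rightFraction L P.isoModSerre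
      (s.ι.app j ≫ (L.objObjPreimageIso s.pt).inv)
    let α : Discrete.functor (fun j ↦ (ψ ⟨j⟩).X') ⟶ F := Discrete.natTrans fun j ↦ (ψ j).s
    let d : colimit (Discrete.functor (fun j ↦ (ψ ⟨j⟩).X')) ⟶ L.objPreimage s.pt :=
      colimit.desc _ ⟨L.objPreimage s.pt, Discrete.natTrans fun j ↦ (ψ j).f⟩
    have hα := Localization.inverts L P.isoModSerre _
      (P.isoModSerre_colimMap α fun j ↦ (ψ j).hs)
    refine ⟨inv (L.map (colimMap α)) ≫ L.map d ≫
      (L.objObjPreimageIso s.pt).hom, fun j ↦ ?_⟩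
    have hs := Localization.inverts L P.isoModSerre _ (ψ j).hs
    rw [← cancel_epi (L.map (ψ j).s)]
    have h₁ : (ψ j).s ≫ colimit.ι F j = colimit.ι _ j ≫ colimMap α := by simp [α]
    have h₃ : colimit.ι (Discrete.functor (fun j ↦ (ψ ⟨j⟩).X')) j ≫ d = (ψ j).f :=
      colimit.ι_desc _ _
    have h₂ : L.map (ψ j).s ≫ s.ι.app j =
        L.map (ψ j).f ≫ (L.objObjPreimageIso s.pt).hom := by
      rw [← cancel_mono (L.objObjPreimageIso s.pt).inv, Category.assoc, hψ,
        MorphismProperty.RightFraction.map_s_comp_map]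
      simp
    rw [h₂]
    dsimp
    rw [← L.map_comp_assoc, h₁, L.map_comp_assoc, IsIso.hom_inv_id_assoc, ← L.map_comp_assoc, h₃]

include P L in
variable (J) in
lemma hasColimitsOfShape_discrete : HasColimitsOfShape (Discrete J) D where
  has_colimit K := by
    have := Localization.essSurj L P.isoModSerre
    have := preservesColimitsOfShape_discrete P L J
    let F : Discrete J ⥤ C := Discrete.functor fun j ↦ L.objPreimage (K.obj ⟨j⟩)
    have e : K ≅ F ⋙ L := Discrete.natIso fun j ↦ (L.objObjPreimageIso (K.obj j)).symm
    exact hasColimit_of_iso e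

end SerreClassLocalization

end ObjectProperty

section

variable {C : Type u} [Category.{v} C] [Abelian C]

lemma exists_hasProjectiveDimensionLT_of_projectiveDimension_lt_top {X : C}
    (h : projectiveDimension X < ⊤) : ∃ n, HasProjectiveDimensionLT X n :=
  let ⟨n, hn⟩ := (projectiveDimension_ne_top_iff X).1 h.ne
  ⟨n + 1, hn⟩

lemma projectiveDimension_lt_top (X : C) (n : ℕ) [HasProjectiveDimensionLT X n] :
    projectiveDimension X < ⊤ :=
  (projectiveDimension_lt_iff.2 ‹_›).trans (WithBot.coe_lt_coe.2 (ENat.natCast_lt_top n))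

lemma exists_hasInjectiveDimensionLE_of_injectiveDimension_lt_top {X : C}
    (h : injectiveDimension X < ⊤) : ∃ n, HasInjectiveDimensionLE X n :=
  (injectiveDimension_ne_top_iff X).1 h.ne

lemma injectiveDimension_lt_top (X : C) (n : ℕ) [HasInjectiveDimensionLT X n] :
    injectiveDimension X < ⊤ :=
  (injectiveDimension_lt_iff.2 ‹_›).trans (WithBot.coe_lt_coe.2 (ENat.natCast_lt_top n))

lemma isZero_of_isZero_isSeparator {T : C} (hT : IsSeparator T) (h : IsZero T) (X : C) :
    IsZero X := by
  rw [IsZero.iff_id_eq_zero]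
  exact (Preadditive.isSeparator_iff T).1 hT _ fun f ↦ h.eq_of_src _ _

end

/-! ### The quotient functor π -/

namespace SerreQuotient

variable {A : Type u} [Category.{v} A] [Abelian A] (B : ObjectProperty A) [B.IsSerreClass]

instance : (π B).Additive := inferInstanceAs B.isoModSerre.Q.Additive

instance : (π B).EssSurj := Localization.essSurj _ B.isoModSerre

instance : PreservesFiniteLimits (π B) :=
  ObjectProperty.SerreClassLocalization.preservesFiniteLimits _ B

instance : PreservesFiniteColimits (π B) :=
  ObjectProperty.SerreClassLocalization.preservesFiniteColimits _ B

instance enoughInjectives [EnoughInjectives A] [(π B).PreservesInjectiveObjects] :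
    EnoughInjectives (SerreQuotient B) where
  presentation X :=
    ⟨{J := (π B).obj (Injective.under ((π B).objPreimage X))
      injective := (π B).injective_obj _
      f := ((π B).objObjPreimageIso X).inv ≫ (π B).map (Injective.ι _)
      mono := inferInstance}⟩

lemma exists_retract_of_injective [EnoughInjectives A] (I : SerreQuotient B) [Injective I] :
    ∃ J : A, Injective J ∧ Nonempty (Retract I ((π B).obj J)) := by
  let f : I ⟶ (π B).obj (Injective.under ((π B).objPreimage I)) :=
    ((π B).objObjPreimageIso I).inv ≫ (π B).map (Injective.ι _)
  exact ⟨_, inferInstance, ⟨⟨f, Injective.factorThru (𝟙 I) f, by simp⟩⟩⟩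

section

variable [HasCoproducts.{w} A]

lemma exists_epi_map_sigma [LocallySmall.{w} A] {T : A} (hT : IsSeparator T)
    (X : SerreQuotient B) : ∃ (J : Type w) (p : (π B).obj (∐ fun _ : J ↦ T) ⟶ X), Epi p := by
  obtain ⟨J, p, _⟩ := exists_epi_sigma_of_isSeparator.{w} hT ((π B).objPreimage X)
  exact ⟨J, (π B).map p ≫ ((π B).objObjPreimageIso X).hom, inferInstance⟩

variable [AB4OfSize.{w} A] [∀ J : Type w, B.IsClosedUnderColimitsOfShape (Discrete J)]

instance (J : Type w) : PreservesColimitsOfShape (Discrete J) (π B) :=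
  ObjectProperty.SerreClassLocalization.preservesColimitsOfShape_discrete B _ J

lemma hasCoproducts : HasCoproducts.{w} (SerreQuotient B) := fun J ↦
  ObjectProperty.SerreClassLocalization.hasColimitsOfShape_discrete B (π B) J

lemma isSeparator_obj [LocallySmall.{w} A] {T : A} (hT : IsSeparator T) :
    IsSeparator ((π B).obj T) := by
  rw [Preadditive.isSeparator_iff]
  intro X Y f hf
  obtain ⟨J, p, _⟩ := exists_epi_map_sigma.{w} B hT X
  rw [← cancel_epi p, comp_zero]
  refine (isColimitOfPreserves (π B) (colimit.isColimit _)).hom_ext fun j ↦ ?_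
  rw [comp_zero, ← Category.assoc]
  exact hf _

end

lemma hasProjectiveDimensionLT_obj_sigma [EnoughInjectives (SerreQuotient B)]
    {J : Type w} (X : J → A) [HasCoproduct X] [PreservesColimitsOfShape (Discrete J) (π B)]
    (n : ℕ) (h : ∀ j, HasProjectiveDimensionLT ((π B).obj (X j)) n) :
    HasProjectiveDimensionLT ((π B).obj (∐ X)) n :=
  hasProjectiveDimensionLT_of_isColimit_cofan (c := Cofan.mk _ fun j ↦ (π B).map (Sigma.ι X j))
    (isColimitCofanMkObjOfIsColimit (π B) _ _ (coproductIsCoproduct X)) n h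

end SerreQuotient

end CategoryTheory

open Limits

theorem theorem4p1 {A : Type u} [Category.{v} A] [Abelian A]
    (hA : IsGorensteinCategory.{w} A)
    (T : A) (hT : IsSeparator T) (hTpd : projectiveDimension T < ⊤)
    (B : ObjectProperty A) [B.IsSerreClass]
    (hB : ∀ J : Type w, B.IsClosedUnderColimitsOfShape (Discrete J))
    (hinj : (SerreQuotient.π B).PreservesInjectiveObjects)
    (hpd : projectiveDimension ((SerreQuotient.π B).obj T) < ⊤) :
    IsGorensteinCategory.{w} (SerreQuotient B) ∧
      gorensteinDimension (SerreQuotient B) ≤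
        gorensteinDimension A + projectiveDimension ((SerreQuotient.π B).obj T) := by
  have := hA.locallySmall
  have := hA.hasCoproducts
  have := hA.ab4
  have := hA.enoughInjectives
  have := LocallySmall.wellPowered_of_isSeparator hT
  have := SerreQuotient.hasCoproducts.{w} B
  have hsep := SerreQuotient.isSeparator_obj.{w} B hT
  -- Used with arbitrary finite bounds for the Gorenstein property, then with the exact dimensions
  -- for the inequality.
  have pd_inj (d t : ℕ) (hd : ∀ I : A, Injective I → HasProjectiveDimensionLT I (d + 1))
      (ht : HasProjectiveDimensionLT ((SerreQuotient.π B).obj T) (t + 1))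
      (I : SerreQuotient B) (_ : Injective I) : HasProjectiveDimensionLT I (d + t + 1) := by
    obtain ⟨J, _, ⟨r⟩⟩ := SerreQuotient.exists_retract_of_injective B I
    have := hd J inferInstance
    have := (SerreQuotient.π B).hasProjectiveDimensionLT_obj_of_exists_epi t (fun X ↦ by
      obtain ⟨J, p, _⟩ := exists_epi_sigma_of_isSeparator.{w} hT X
      exact ⟨_, p, inferInstance,
        SerreQuotient.hasProjectiveDimensionLT_obj_sigma B _ _ fun _ ↦ ht⟩) J (d + 1)
    rw [add_right_comm]
    exact r.hasProjectiveDimensionLT _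
  obtain ⟨t, ht⟩ := (projectiveDimension_ne_top_iff _).1 hpd.ne
  obtain ⟨d, hd⟩ := hA.exists_bound
  simp only [projectiveDimension_le_iff] at hd
  have id_sigma (J : Type w) : ∃ s,
      HasInjectiveDimensionLT ((SerreQuotient.π B).obj (∐ fun _ : J ↦ T)) s := by
    obtain ⟨n, hn⟩ := exists_hasProjectiveDimensionLT_of_projectiveDimension_lt_top hTpd
    have : HasProjectiveDimensionLT (∐ fun _ : J ↦ T) n :=
      hasProjectiveDimensionLT_of_isColimit_cofan (coproductIsCoproduct fun _ : J ↦ T) n fun _ ↦ hn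
    obtain ⟨s, hs⟩ := exists_hasInjectiveDimensionLE_of_injectiveDimension_lt_top
      ((hA.projectiveDimension_lt_top_iff (∐ fun _ : J ↦ T)).1 (projectiveDimension_lt_top _ n))
    exact ⟨s + 1, (SerreQuotient.π B).hasInjectiveDimensionLT_obj s _⟩
  refine ⟨⟨?_, inferInstance, ⟨fun J ↦ ?_⟩, inferInstance, ⟨_, hsep, hpd⟩, fun X ↦ ⟨fun hX ↦ ?_,
    fun hX ↦ ?_⟩, ⟨d + t, fun I hI ↦ ?_⟩⟩, ?_⟩
  · exact ObjectProperty.SerreClassLocalization.locallySmall B (SerreQuotient.π B)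
  · exact hasExactColimitsOfShape_discrete_of_enoughInjectives J
  · obtain ⟨m, hm⟩ := exists_hasProjectiveDimensionLT_of_projectiveDimension_lt_top hX
    obtain ⟨s, hs⟩ := exists_hasInjectiveDimensionLT_of_hasProjectiveDimensionLT (fun Y ↦ by
      obtain ⟨J, p, hp⟩ := SerreQuotient.exists_epi_map_sigma.{w} B hT Y
      obtain ⟨s, hs⟩ := id_sigma J
      exact ⟨_, p, s, hp, hs⟩) X m
    exact injectiveDimension_lt_top X s
  · obtain ⟨m, hm⟩ := exists_hasInjectiveDimensionLE_of_injectiveDimension_lt_top hX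
    have := exists_hasProjectiveDimensionLT_of_hasInjectiveDimensionLT (d + t + 1)
      (pd_inj d t hd ht) m X
    exact projectiveDimension_lt_top X (d + t + 1)
  · exact_mod_cast (projectiveDimension_le_iff I (d + t)).2 (pd_inj d t hd ht I hI)
  · refine iSup₂_le fun I hI ↦ ?_
    have hG : gorensteinDimension A ≤ d :=
      iSup₂_le fun I hI ↦ (projectiveDimension_le_iff I d).2 (hd I hI)
    have hle (I : A) (hI : Injective I) : projectiveDimension I ≤ gorensteinDimension A :=
      le_iSup₂ (f := fun (I : A) (_ : Injective I) ↦ projectiveDimension I) I hI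
    -- If π(T) is zero, so is the quotient, and its dimension is `⊥`. Otherwise both summands are
    -- natural numbers: were all injectives of `A` zero, `T` would be too.
    by_cases h0 : IsZero ((SerreQuotient.π B).obj T)
    · rw [(projectiveDimension_eq_bot_iff I).2 (isZero_of_isZero_isSeparator hsep h0 I)]
      exact bot_le
    · have hG0 : gorensteinDimension A ≠ ⊥ := fun h ↦ h0 <| by
        have hz : IsZero (Injective.under T) := by
          rw [← projectiveDimension_eq_bot_iff, ← le_bot_iff, ← h]
          exact hle _ inferInstance
        exact (SerreQuotient.π B).map_isZero (hz.of_mono (Injective.ι T))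
      have hp0 := mt (projectiveDimension_eq_bot_iff _).1 h0
      have key (x : WithBot ℕ∞) (n : ℕ) (hx : x ≤ n) (hx0 : x ≠ ⊥) : ∃ m : ℕ, x = m := by
        induction x with
        | bot => exact absurd rfl hx0
        | coe x =>
          obtain ⟨m, rfl⟩ := ENat.ne_top_iff_exists.1
            (ne_top_of_le_ne_top (ENat.natCast_ne_top n) (WithBot.coe_le_coe.1 hx))
          exact ⟨m, rfl⟩
      obtain ⟨a, ha⟩ := key _ d hG hG0
      obtain ⟨b, hb⟩ := key _ t ((projectiveDimension_le_iff _ t).2 ht) hp0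
      rw [ha, hb]
      exact_mod_cast (projectiveDimension_le_iff I (a + b)).2 (pd_inj a b
        (fun J hJ ↦ (projectiveDimension_le_iff J a).1 (ha ▸ hle J hJ))
        ((projectiveDimension_le_iff _ b).1 hb.le) I hI)
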